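/- Let $A:\mathbb N\times\mathbb N\to\mathbb N$ be the Ackermann function given by $A(0,n)=2^n$, $A(k,0)=1$ and $A(k+1,n+1)=A(k,A(k+1,n))$ for all $k,n\in\mathbb N$, and put $A_k(n)=A(k,n)$. Each $A_k$ is unbounded; for $m\in\mathbb N$ let $\mathrm{Inv}_{A_k}(m)$ be the least $n\in\mathbb N$ with $A_k(n)\ge m$. For $m\in\mathbb N$ let $|m|$ be the length of the binary representation of $m$ (so $|0|=1$), and for $m\ge 1$ let $\log(m)=\lceil\log_2 m\rceil$. Then for every $k\in\mathbb N$: (i) $\mathrm{Inv}_{A_k}$ is computable in linear time: there are a deterministic multitape Turing machine and a constant $C$ (both depending on $k$) such that, for every $m\in\mathbb N$, the machine started on the binary representation of $m$ halts after at most $C\,|m|$ steps with the binary representation of $\mathrm{Inv}_{A_k}(m)$ on its output tape; (ii) for every $m\in\mathbb N$, $\mathrm{Inv}_{A_{k+1}}(m)$ is the least $s\in\mathbb N$ such that the $s$-th iterate of $\mathrm{Inv}_{A_k}$ at $m$ is at most $1$; (iii) for every $m\ge 4$, $\mathrm{Inv}_{A_{k+1}}(m)\le 2\log(\log(m))$.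 -/

import Mathlib

namespace InvAck

/-! ### The Ackermann function and inverses -/

/-- The two-argument Ackermann function with `A(0, n) = 2 ^ n`, `A(k, 0) = 1` and
`A(k + 1, n + 1) = A(k, A(k + 1, n))`. -/
def A : ℕ → ℕ → ℕ
  | 0, n => 2 ^ n
  | _ + 1, 0 => 1
  | k + 1, n + 1 => A k (A (k + 1) n)
termination_by k n => (k, n)

theorem lt_A (k n : ℕ) : n < A k n := by
  induction k generalizing n with
  | zero => rw [A]; exact Nat.lt_two_pow_self
  | succ k ihk =>
    induction n with
    | zero => rw [A]; exact Nat.one_pos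
    | succ n ihn => rw [A]; exact lt_of_le_of_lt ihn (ihk _)

theorem A_unbounded (k : ℕ) : ∀ m, ∃ n, m ≤ A k n :=
  fun m => ⟨m, (lt_A k m).le⟩

/-- The inverse of an unbounded function `f`: the least `n` with `f n ≥ m`. -/
def inverse (f : ℕ → ℕ) (hf : ∀ m, ∃ n, m ≤ f n) (m : ℕ) : ℕ :=
  Nat.find (hf m)

/-- `Inv_{A_k}`, the inverse of `A_k = A(k, ·)`. -/
def invA (k : ℕ) : ℕ → ℕ :=
  inverse (A k) (A_unbounded k)

/-! ### Binary representation -/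

/-- The binary representation of a natural number, most significant bit first;
the representation of `0` is the one-letter word `0`. -/
def binRep (n : ℕ) : List Bool :=
  if n = 0 then [false] else n.bits.reverse

/-! ### Multitape Turing machines -/

/-- Tape symbols: the blank `none`, the two bits, and the further work symbols in `Γ`. -/
abbrev TapeSymbol (Γ : Type) : Type := Option (Bool ⊕ Γ)

/-- A deterministic multitape Turing machine. The finite type `K` indexes the tapes. In state `q`,
scanning the symbols `a`, the machine halts if `δ q a = none`; if `δ q a = some (q', b)`,
it goes to state `q'` and on each tape `i` writes `(b i).1` and then moves the head one cell
in the direction `(b i).2` (`none` means that the head stays). -/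
structure MultitapeTM where
  K : Type
  [decEqK : DecidableEq K]
  [fintypeK : Fintype K]
  Γ : Type
  [fintypeΓ : Fintype Γ]
  Q : Type
  [fintypeQ : Fintype Q]
  start : Q
  input : K
  output : K
  δ : Q → (K → TapeSymbol Γ) → Option (Q × (K → TapeSymbol Γ × Option Turing.Dir))

namespace MultitapeTM

attribute [instance] decEqK fintypeK fintypeΓ fintypeQ

variable (M : MultitapeTM)

/-- A configuration: the state together with the tapes (with the positions of their heads). -/
structure Cfg where
  state : M.Q
  tape : M.K → Turing.Tape (TapeSymbol M.Γ)

/-- Write a symbol in the scanned cell and then move the head. -/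
def act {Γ : Type} (T : Turing.Tape (TapeSymbol Γ)) (b : TapeSymbol Γ × Option Turing.Dir) :
    Turing.Tape (TapeSymbol Γ) :=
  match b.2 with
  | none => T.write b.1
  | some d => (T.write b.1).move d

/-- One step of the machine; `none` if the configuration is halting. -/
def step (c : M.Cfg) : Option M.Cfg :=
  (M.δ c.state (fun i => (c.tape i).head)).map
    fun r => ⟨r.1, fun i => act (c.tape i) (r.2 i)⟩

/-- The tape containing the binary word `w` and blanks elsewhere, with the head on the first
letter of `w`. -/
def wordTape (Γ : Type) (w : List Bool) : Turing.Tape (TapeSymbol Γ) :=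
  Turing.Tape.mk₁ (w.map fun b => some (Sum.inl b))

/-- The initial configuration on the binary word `w`: all tapes but the input tape are blank. -/
def init (w : List Bool) : M.Cfg :=
  ⟨M.start, fun i => if i = M.input then wordTape M.Γ w else wordTape M.Γ []⟩

/-- On input `w`, the machine halts after at most `t` steps with output `v`. -/
def OutputsWithin (w v : List Bool) (t : ℕ) : Prop :=
  ∃ c : M.Cfg, Nonempty (StateTransition.EvalsToInTime M.step (M.init w) (some c) t) ∧
    M.step c = none ∧ c.tape M.output = wordTape M.Γ v

end MultitapeTM

/-- `f` is computable in linear time: some multitape Turing machine computes `f` in binary,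
taking at most `C * |n|` steps on every `n`, where `|n|` is the length of the binary
representation of `n`. -/
def LinearTimeComputable (f : ℕ → ℕ) : Prop :=
  ∃ (M : MultitapeTM) (C : ℕ), ∀ n : ℕ,
    M.OutputsWithin (binRep n) (binRep (f n)) (C * (binRep n).length)

end InvAck

namespace InvAck

/-! ### Arithmetic of the Ackermann function and its inverses -/

/-! Everything rests on the Galois connection `invA_le_iff`: `invA k m ≤ n` iff `m ≤ A k n`.
Iterating it `s` times and taking `n = 1` gives (ii), because `A (k + 1) s` is the `s`-th iterate of
`A k` at `1`. The bound (iii) becomes a lower bound for `A (k + 1)`, hence for `A 1`, which already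
dominates `2 ^ 2 ^ c` at `2 * c`.

For (i), the input is scanned only once: `invA 0 m` is `⌈log₂ m⌉`, which is read off the length of
the binary word and whether a `1` occurs after the leading one. It is stored in unary, on a counter
of size at most `|m|`. All further work is on counters, where time linear in the value suffices. By
`invA_succ_eq`, `invA (k + 1) m = invA (k + 1) (invA k m) + 1` for `m ≥ 2`, so passing from `k` to
`k + 1` only needs `invA (k + 1)` at a counter value.

On counters, `invA (k + 1)` is computed by iterating `invA k` and counting the rounds; `invA 0`
arises likewise from `n ↦ ⌈n/2⌉`. Each round roughly halves the value (`invA_le_half`), so linear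
costs add up to a geometric series and stay linear (`CounterComputable.countIterates`). The binary
output is obtained by repeated halving, with the same accounting. -/

theorem A_zero_right (k : ℕ) : A k 0 = 1 := by
  cases k <;> simp [A]

theorem A_strictMono (k : ℕ) : StrictMono (A k) := by
  refine strictMono_nat_of_lt_succ fun n => ?_
  cases k with
  | zero => simp only [A]; exact Nat.pow_lt_pow_right one_lt_two n.lt_succ_self
  | succ k => rw [A.eq_3]; exact lt_A _ _

theorem A_le_A_succ (k n : ℕ) : A k n ≤ A (k + 1) n := by
  cases n with
  | zero => simp [A_zero_right]
  | succ n => rw [A.eq_3]; exact (A_strictMono k).monotone (lt_A (k + 1) n)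

theorem A_le_A_of_le {j k : ℕ} (h : j ≤ k) (n : ℕ) : A j n ≤ A k n :=
  monotone_nat_of_le_succ (f := fun k => A k n) (fun k => A_le_A_succ k n) h

theorem iterate_A_one (k s : ℕ) : (A k)^[s] 1 = A (k + 1) s := by
  induction s with
  | zero => simp [A_zero_right]
  | succ s ih => rw [Function.iterate_succ_apply', ih, A.eq_3]

theorem invA_le_iff (k m n : ℕ) : invA k m ≤ n ↔ m ≤ A k n := by
  unfold invA inverse
  rw [Nat.find_le_iff]
  exact ⟨fun ⟨i, hi, h⟩ => h.trans ((A_strictMono k).monotone hi), fun h => ⟨n, le_rfl, h⟩⟩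

/-- Adjunctions compose. -/
theorem iterate_invA_le_iff (k s m n : ℕ) : (invA k)^[s] m ≤ n ↔ m ≤ (A k)^[s] n := by
  induction s generalizing m with
  | zero => rfl
  | succ s ih => rw [Function.iterate_succ_apply, ih, invA_le_iff, Function.iterate_succ_apply']

theorem isLeast_invA_succ (k m : ℕ) :
    IsLeast {s : ℕ | (invA k)^[s] m ≤ 1} (invA (k + 1) m) := by
  have h : {s : ℕ | (invA k)^[s] m ≤ 1} = Set.Ici (invA (k + 1) m) := by
    ext s
    rw [Set.mem_ofPred_eq, iterate_invA_le_iff, iterate_A_one, Set.mem_Ici, invA_le_iff]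
  rw [h]
  exact isLeast_Ici

theorem two_pow_two_pow_le_A (c : ℕ) (hc : 1 ≤ c) : 2 ^ 2 ^ c ≤ A 1 (2 * c) := by
  induction c, hc using Nat.le_induction with
  | base => simp [A]
  | succ c _ ih =>
    rw [Nat.mul_succ, A.eq_3, A.eq_3]
    simp only [A.eq_1]
    -- Here `A 1 (2 * c + 2)` is `2 ^ 2 ^ A 1 (2 * c)`, and the exponent satisfies `A 1 (2 * c) > 2
    -- * c ≥ c + 1`.
    have := lt_A (0 + 1) (2 * c)
    exact Nat.pow_le_pow_right two_pos (Nat.pow_le_pow_right two_pos (by omega))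

theorem invA_succ_le_two_mul_clog (k m : ℕ) (hm : 4 ≤ m) :
    invA (k + 1) m ≤ 2 * (Nat.clog 2)^[2] m := by
  change invA (k + 1) m ≤ 2 * Nat.clog 2 (Nat.clog 2 m)
  have h2 : 1 < Nat.clog 2 m := by
    rw [← not_le, Nat.clog_le_iff_le_pow one_lt_two]; omega
  rw [invA_le_iff]
  calc m ≤ 2 ^ Nat.clog 2 m := Nat.le_pow_clog one_lt_two _
    _ ≤ 2 ^ 2 ^ Nat.clog 2 (Nat.clog 2 m) :=
      Nat.pow_le_pow_right two_pos (Nat.le_pow_clog one_lt_two _)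
    _ ≤ A 1 (2 * Nat.clog 2 (Nat.clog 2 m)) := two_pow_two_pow_le_A _ (Nat.clog_pos one_lt_two h2)
    _ ≤ _ := A_le_A_of_le (by omega) _

theorem invA_eq_zero_iff (k m : ℕ) : invA k m = 0 ↔ m ≤ 1 := by
  rw [← Nat.le_zero, invA_le_iff, A_zero_right]

/-- Both sides have the same upper bounds: for `s + 1` this is the recursion of `A` read through the
Galois connection, and `m ≥ 2` excludes the bound `0`. -/
theorem invA_succ_eq (k m : ℕ) (hm : 2 ≤ m) :
    invA (k + 1) m = invA (k + 1) (invA k m) + 1 := by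
  refine eq_of_forall_ge_iff fun s => ?_
  cases s with
  | zero => simp [invA_eq_zero_iff]; omega
  | succ s => rw [Nat.succ_le_succ_iff, invA_le_iff, invA_le_iff, invA_le_iff, A.eq_3]

/-- The analogue one level down: `A 0` iterates doubling, whose inverse is `m ↦ ⌈m/2⌉`. -/
theorem invA_zero_eq (m : ℕ) (hm : 2 ≤ m) : invA 0 m = invA 0 ((m + 1) / 2) + 1 := by
  refine eq_of_forall_ge_iff fun s => ?_
  cases s with
  | zero => simp [invA_eq_zero_iff]; omega
  | succ s =>
    rw [Nat.succ_le_succ_iff, invA_le_iff, invA_le_iff, A.eq_1, A.eq_1, pow_succ]; omega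

theorem invA_le_invA_of_le {j k : ℕ} (h : j ≤ k) (m : ℕ) : invA k m ≤ invA j m := by
  rw [invA_le_iff]
  exact ((invA_le_iff j m _).1 le_rfl).trans (A_le_A_of_le h _)

theorem two_mul_le_two_pow (j : ℕ) : 2 * j ≤ 2 ^ j := by
  cases j with
  | zero => simp
  | succ j => have := @Nat.lt_two_pow_self j; rw [pow_succ]; omega

/-- The inverses decrease in `k`, and `m ≤ 2 * ⌈m/2⌉ ≤ 2 ^ ⌈m/2⌉` settles `k = 0`. This decay makes
iteration of a linear-time inverse linear again. -/
theorem invA_le_half (k m : ℕ) : invA k m ≤ (m + 1) / 2 := by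
  refine (invA_le_invA_of_le k.zero_le m).trans ?_
  rw [invA_le_iff, A.eq_1]
  have := two_mul_le_two_pow ((m + 1) / 2)
  omega

/-! ### Reading `⌈log₂ m⌉` off the binary representation -/

/-- Induction on the lowest bit. The last clause detects powers of two, the only case in which
`⌈log₂ m⌉` is not one more than the length of `w`. -/
theorem bits_reverse_of_pos (m : ℕ) (hm : 0 < m) :
    ∃ w : List Bool, m.bits.reverse = true :: w ∧ 2 ^ w.length ≤ m ∧ m < 2 ^ (w.length + 1) ∧
      (m = 2 ^ w.length ↔ w.count true = 0) := by
  induction m using Nat.strong_induction_on with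
  | _ m ih =>
    rcases Nat.lt_or_ge m 2 with h | h
    · obtain rfl : m = 1 := by omega
      exact ⟨[], by simp⟩
    obtain ⟨w, h₁, h₂, h₃, h₄⟩ := ih (m / 2) (by omega) (by omega)
    rcases Nat.mod_two_eq_zero_or_one m with hb | hb
    · have e : m = 2 * (m / 2) := by omega
      refine ⟨w ++ [false], ?_, ?_, ?_, ?_⟩
      · rw [e, Nat.bit0_bits _ (by omega)]; simp [h₁]
      · simp [pow_succ] at *; omega
      · simp [pow_succ] at *; omega
      · simp only [List.length_append, List.length_singleton, List.count_append, pow_succ] at *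
        simp only [List.count_singleton]
        simp
        omega
    · have e : m = 2 * (m / 2) + 1 := by omega
      refine ⟨w ++ [true], ?_, ?_, ?_, ?_⟩
      · rw [e, Nat.bit1_bits]; simp [h₁]
      · simp [pow_succ] at *; omega
      · simp [pow_succ] at *; omega
      · simp [pow_succ] at *; omega

theorem binRep_of_pos (m : ℕ) (hm : 0 < m) :
    ∃ w : List Bool, binRep m = true :: w ∧
      invA 0 m = w.length + if w.count true = 0 then 0 else 1 := by
  obtain ⟨w, h₁, h₂, h₃, h₄⟩ := bits_reverse_of_pos m hm
  refine ⟨w, by rw [binRep, if_neg hm.ne', h₁], ?_⟩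
  refine le_antisymm ?_ ?_
  · rw [invA_le_iff, A.eq_1]
    split_ifs with h
    · exact (h₄.2 h).le
    · exact h₃.le
  · by_contra! hlt
    split_ifs at hlt with h
    · have := (invA_le_iff 0 m (w.length - 1)).1 (by omega)
      rw [A.eq_1] at this
      have : 2 ^ (w.length - 1) < 2 ^ w.length := Nat.pow_lt_pow_right one_lt_two (by omega)
      omega
    · have := (invA_le_iff 0 m w.length).1 (by omega)
      rw [A.eq_1] at this
      exact h (h₄.1 (le_antisymm this h₂))

theorem bits_reverse_eq_append (n : ℕ) (hn : n ≠ 0) :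
    n.bits.reverse = (n / 2).bits.reverse ++ [decide (n % 2 ≠ 0)] := by
  rcases Nat.mod_two_eq_zero_or_one n with hb | hb
  · have e : n = 2 * (n / 2) := by omega
    conv_lhs => rw [e, Nat.bit0_bits _ (by omega)]
    simp [hb]
  · have e : n = 2 * (n / 2) + 1 := by omega
    conv_lhs => rw [e, Nat.bit1_bits]
    simp [hb]

end InvAck

namespace InvAck

open Turing

/-! ### Program fragments for multitape machines

A fragment is the control of a multitape machine with a designated exit. Fragments are composed
sequentially, by case distinction and by iteration. -/

/-- The control part of a multitape machine; a transition to `none` leaves the fragment. -/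
structure Fragment (K Γ : Type) where
  Q : Type
  [fintypeQ : Fintype Q]
  start : Q
  δ : Q → (K → TapeSymbol Γ) → Option Q × (K → TapeSymbol Γ × Option Dir)

namespace Fragment

attribute [instance] fintypeQ

variable {K Γ : Type}

/-- The symbols scanned on the tapes. -/
def heads (T : K → Tape (TapeSymbol Γ)) : K → TapeSymbol Γ := fun i => (T i).head

/-- Write and move on all the tapes. -/
def actAll (T : K → Tape (TapeSymbol Γ)) (b : K → TapeSymbol Γ × Option Dir) :
    K → Tape (TapeSymbol Γ) :=
  fun i => MultitapeTM.act (T i) (b i)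

/-- The action that leaves the tapes unchanged. -/
def idle (h : K → TapeSymbol Γ) : K → TapeSymbol Γ × Option Dir := fun i => (h i, none)

@[simp]
theorem actAll_idle (T : K → Tape (TapeSymbol Γ)) : actAll T (idle (heads T)) = T := by
  funext i
  exact Tape.write_self (T i)

/-- `F.Leaves q T U n`: started in state `q` on the tapes `T`, the fragment `F` is left
after at most `n` steps with the tapes `U`. -/
inductive Leaves (F : Fragment K Γ) :
    F.Q → (K → Tape (TapeSymbol Γ)) → (K → Tape (TapeSymbol Γ)) → ℕ → Prop
  | exit {q T b} (n : ℕ) (h : F.δ q (heads T) = (none, b)) : Leaves F q T (actAll T b) (n + 1)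
  | step {q r T U b n} (h : F.δ q (heads T) = (some r, b))
      (hr : Leaves F r (actAll T b) U n) : Leaves F q T U (n + 1)

/-- Started on the tapes `T`, the fragment is left after at most `n` steps with the tapes `U`. -/
def Runs (F : Fragment K Γ) (T U : K → Tape (TapeSymbol Γ)) (n : ℕ) : Prop :=
  F.Leaves F.start T U n

theorem Leaves.mono {F : Fragment K Γ} {q T T' n} (h : F.Leaves q T T' n) :
    ∀ {m}, n ≤ m → F.Leaves q T T' m := by
  induction h with
  | exit n h =>
    intro m hm
    obtain ⟨m, rfl⟩ := Nat.exists_eq_add_of_le' (show 1 ≤ m by omega)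
    exact .exit m h
  | step h h' ih =>
    intro m hm
    obtain ⟨m, rfl⟩ := Nat.exists_eq_add_of_le' (show 1 ≤ m by omega)
    exact .step h (ih (by omega))

theorem Runs.congr {F : Fragment K Γ} {T T' T'' n m} (h : F.Runs T T' n) (hT : T' = T'')
    (hn : n ≤ m) : F.Runs T T'' m :=
  hT ▸ Leaves.mono h hn

/-- A single step. -/
def single (a : (K → TapeSymbol Γ) → K → TapeSymbol Γ × Option Dir) : Fragment K Γ where
  Q := Unit
  start := ()
  δ _ h := (none, a h)

theorem runs_single (a : (K → TapeSymbol Γ) → K → TapeSymbol Γ × Option Dir)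
    (T : K → Tape (TapeSymbol Γ)) : (single a).Runs T (actAll T (a (heads T))) 1 :=
  .exit 0 rfl

/-- Sequential composition. -/
def seq (F G : Fragment K Γ) : Fragment K Γ where
  Q := F.Q ⊕ G.Q
  start := .inl F.start
  δ
    | .inl q, h => (some (((F.δ q h).1.map .inl).getD (.inr G.start)), (F.δ q h).2)
    | .inr q, h => ((G.δ q h).1.map .inr, (G.δ q h).2)

theorem Leaves.seq_right {F G : Fragment K Γ} {q T T' n} (h : G.Leaves q T T' n) :
    (F.seq G).Leaves (.inr q) T T' n := by
  induction h with
  | exit n h => exact .exit n (by simp [seq, h])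
  | step h h' ih => exact .step (by simp [seq, h]) ih

theorem Leaves.seq_left {F G : Fragment K Γ} {q T T' T'' n m} (h : F.Leaves q T T' n)
    (hG : G.Runs T' T'' m) : (F.seq G).Leaves (.inl q) T T'' (n + m) := by
  induction h with
  | exit n h =>
    -- The exit step of `F` is redirected to the start of `G`, so composition costs no extra step.
    refine Leaves.mono (.step (n := m) (by simp [seq, h]) (Leaves.seq_right hG)) (by omega)
  | step h h' ih =>
    rw [Nat.add_right_comm]
    exact .step (by simp [seq, h]) (ih hG)

theorem Runs.seq {F G : Fragment K Γ} {T T' T'' n m} (hF : F.Runs T T' n) (hG : G.Runs T' T'' m) :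
    (F.seq G).Runs T T'' (n + m) :=
  Leaves.seq_left hF hG

/-- Case distinction according to the scanned symbols. -/
def cond (c : (K → TapeSymbol Γ) → Bool) (F G : Fragment K Γ) : Fragment K Γ where
  Q := Option (F.Q ⊕ G.Q)
  start := none
  δ
    | none, h => (some (some (bif c h then .inl F.start else .inr G.start)), idle h)
    | some (.inl q), h => ((F.δ q h).1.map fun q' => some (.inl q'), (F.δ q h).2)
    | some (.inr q), h => ((G.δ q h).1.map fun q' => some (.inr q'), (G.δ q h).2)

theorem Runs.cond_true {c : (K → TapeSymbol Γ) → Bool} {F G : Fragment K Γ} {T T' n}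
    (hc : c (heads T) = true) (hF : F.Runs T T' n) : (cond c F G).Runs T T' (n + 1) := by
  refine .step (r := some (.inl F.start)) (b := idle (heads T)) (by simp [cond, hc]) ?_
  rw [actAll_idle]
  clear hc
  unfold Runs at hF
  generalize F.start = q at hF ⊢
  induction hF with
  | exit n h => exact .exit n (by simp [cond, h])
  | step h h' ih => exact .step (by simp [cond, h]) ih

theorem Runs.cond_false {c : (K → TapeSymbol Γ) → Bool} {F G : Fragment K Γ} {T T' n}
    (hc : c (heads T) = false) (hG : G.Runs T T' n) : (cond c F G).Runs T T' (n + 1) := by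
  refine .step (r := some (.inr G.start)) (b := idle (heads T)) (by simp [cond, hc]) ?_
  rw [actAll_idle]
  clear hc
  unfold Runs at hG
  generalize G.start = q at hG ⊢
  induction hG with
  | exit n h => exact .exit n (by simp [cond, h])
  | step h h' ih => exact .step (by simp [cond, h]) ih

/-- Iteration as long as the scanned symbols satisfy `c`. -/
def loop (c : (K → TapeSymbol Γ) → Bool) (F : Fragment K Γ) : Fragment K Γ where
  Q := Option F.Q
  start := none
  δ
    | none, h => (bif c h then some (some F.start) else none, idle h)
    | some q, h => (some (F.δ q h).1, (F.δ q h).2)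

theorem runs_loop_false {c : (K → TapeSymbol Γ) → Bool} {F : Fragment K Γ} {T}
    (hc : c (heads T) = false) : (loop c F).Runs T T 1 := by
  have := Leaves.exit (F := loop c F) (q := none) (T := T) (b := idle (heads T)) 0
    (by simp [loop, hc])
  rwa [actAll_idle] at this

theorem Runs.loop_true {c : (K → TapeSymbol Γ) → Bool} {F : Fragment K Γ} {T T' T'' n m}
    (hc : c (heads T) = true) (hF : F.Runs T T' n) (h : (loop c F).Runs T' T'' m) :
    (loop c F).Runs T T'' (n + m + 1) := by
  refine .step (r := some F.start) (b := idle (heads T)) (by simp [loop, hc]) ?_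
  rw [actAll_idle]
  clear hc
  unfold Runs at hF
  generalize F.start = q at hF ⊢
  induction hF with
  | exit n hq => exact Leaves.mono (.step (n := m) (by simp [loop, hq]) h) (by omega)
  | step hq _ ih =>
    rw [Nat.add_right_comm]
    exact .step (by simp [loop, hq]) (ih h)

/-- The multitape machine with the given control, input tape and output tape. -/
def toTM [DecidableEq K] [Fintype K] [Fintype Γ] (F : Fragment K Γ) (inp out : K) :
    MultitapeTM where
  K := K
  Γ := Γ
  Q := Option F.Q
  start := some F.start
  input := inp
  output := out
  δ q h := q.map fun q => F.δ q h

theorem step_toTM [DecidableEq K] [Fintype K] [Fintype Γ] (F : Fragment K Γ) (inp out : K)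
    (q : F.Q) (T : K → Tape (TapeSymbol Γ)) :
    (F.toTM inp out).step ⟨some q, T⟩ =
      some ⟨(F.δ q (heads T)).1, actAll (K := K) (Γ := Γ) T (F.δ q (heads T)).2⟩ :=
  rfl

theorem Leaves.evals [DecidableEq K] [Fintype K] [Fintype Γ] {F : Fragment K Γ} (inp out : K)
    {q T T' n} (h : F.Leaves q T T' n) :
    Nonempty (StateTransition.EvalsToInTime (F.toTM inp out).step ⟨some q, T⟩
      (some ⟨none, T'⟩) n) := by
  induction h with
  | exit n h =>
    refine ⟨⟨⟨1, ?_⟩, Nat.le_add_left 1 n⟩⟩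
    exact (step_toTM F inp out _ _).trans (by rw [h])
  | step h _ ih =>
    obtain ⟨⟨⟨s, hs⟩, hn⟩⟩ := ih
    refine ⟨⟨⟨s + 1, ?_⟩, Nat.succ_le_succ hn⟩⟩
    rw [Function.iterate_succ_apply, ← hs]
    congr 1
    exact (step_toTM F inp out _ _).trans (by rw [h])

theorem Runs.outputsWithin [DecidableEq K] [Fintype K] [Fintype Γ] {F : Fragment K Γ} {inp out : K}
    {w v : List Bool} {T' n}
    (h : F.Runs (fun i => if i = inp then MultitapeTM.wordTape Γ w else MultitapeTM.wordTape Γ [])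
      T' n) (hv : T' out = MultitapeTM.wordTape Γ v) :
    (F.toTM inp out).OutputsWithin w v n :=
  ⟨⟨none, T'⟩, Leaves.evals inp out h, rfl, hv⟩

end Fragment

end InvAck

namespace InvAck

open Turing

namespace Fragment

/-! ### Counters

A counter is a tape with a single mark; its value is the distance of the head to the right of
the mark. -/

/-- The tape of a counter with value `v`. -/
def counterTape (v : ℕ) : Tape (TapeSymbol Unit) :=
  (Tape.move Dir.right)^[v] (Tape.mk₁ [some (Sum.inr ())])

theorem head_counterTape_zero : (counterTape 0).head = some (Sum.inr ()) := rfl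

theorem head_counterTape_of_ne_zero {v : ℕ} (hv : v ≠ 0) : (counterTape v).head = none := by
  obtain ⟨v, rfl⟩ := Nat.exists_eq_succ_of_ne_zero hv
  rw [counterTape, Tape.move_right_n_head, Tape.mk₁, Tape.mk₂, Tape.mk'_nth_nat,
    ListBlank.nth_mk]
  rfl

theorem move_right_counterTape (v : ℕ) :
    (counterTape v).move Dir.right = counterTape (v + 1) :=
  (Function.iterate_succ_apply' ..).symm

theorem move_left_counterTape (v : ℕ) (hv : v ≠ 0) :
    (counterTape v).move Dir.left = counterTape (v - 1) := by
  obtain ⟨v, rfl⟩ := Nat.exists_eq_succ_of_ne_zero hv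
  rw [Nat.succ_eq_add_one, ← move_right_counterTape, Tape.move_right_left, Nat.add_sub_cancel]

variable {ι : Type}

/-- The tapes of a machine with input tape `I`, output tape `O` and counters with values `σ`. -/
def counterTapes (I O : Tape (TapeSymbol Unit)) (σ : ι → ℕ) :
    Bool ⊕ ι → Tape (TapeSymbol Unit)
  | .inl false => I
  | .inl true => O
  | .inr i => counterTape (σ i)

/-- The test whether the counter `i` is nonzero. -/
def nonzero (i : ι) (h : Bool ⊕ ι → TapeSymbol Unit) : Bool := decide (h (.inr i) = none)

theorem nonzero_heads (i : ι) (I O : Tape (TapeSymbol Unit)) (σ : ι → ℕ) :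
    nonzero i (heads (counterTapes I O σ)) = decide (σ i ≠ 0) := by
  simp only [nonzero, heads, counterTapes]
  by_cases h : σ i = 0
  · simp [h, head_counterTape_zero]
  · simp [h, head_counterTape_of_ne_zero]

theorem nonzero_heads_true {i : ι} {I O : Tape (TapeSymbol Unit)} {σ : ι → ℕ} (h : σ i ≠ 0) :
    nonzero i (heads (counterTapes I O σ)) = true := by simp [nonzero_heads, h]

theorem nonzero_heads_false {i : ι} {I O : Tape (TapeSymbol Unit)} {σ : ι → ℕ} (h : σ i = 0) :
    nonzero i (heads (counterTapes I O σ)) = false := by simp [nonzero_heads, h]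

/-- The fragment that does nothing. -/
def skip : Fragment (Bool ⊕ ι) Unit := single idle

theorem runs_skip (T : Bool ⊕ ι → Tape (TapeSymbol Unit)) : skip.Runs T T 1 :=
  (runs_single idle T).congr (actAll_idle T) le_rfl

variable [DecidableEq ι]

/-- A step that acts on the tape `j` only. -/
def onTape (j : Bool ⊕ ι) (b : TapeSymbol Unit → TapeSymbol Unit × Option Dir) :
    Fragment (Bool ⊕ ι) Unit :=
  single fun h i => if i = j then b (h i) else (h i, none)

theorem runs_onTape (j : Bool ⊕ ι) (b : TapeSymbol Unit → TapeSymbol Unit × Option Dir)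
    (T : Bool ⊕ ι → Tape (TapeSymbol Unit)) :
    (onTape j b).Runs T (Function.update T j (MultitapeTM.act (T j) (b (T j).head))) 1 := by
  refine (runs_single _ _).congr (funext fun i => ?_) le_rfl
  by_cases h : i = j
  · subst h
    simp [actAll, heads]
  · simp [actAll, heads, h, MultitapeTM.act]

theorem update_counterTapes_input (I I' O : Tape (TapeSymbol Unit)) (σ : ι → ℕ) :
    Function.update (counterTapes I O σ) (.inl false) I' = counterTapes I' O σ := by
  funext j
  rcases j with (_ | _) | j <;> rfl

theorem update_counterTapes_output (I O O' : Tape (TapeSymbol Unit)) (σ : ι → ℕ) :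
    Function.update (counterTapes I O σ) (.inl true) O' = counterTapes I O' σ := by
  funext j
  rcases j with (_ | _) | j <;> rfl

theorem update_counterTapes_counter (I O : Tape (TapeSymbol Unit)) (σ : ι → ℕ) (i : ι) (v : ℕ) :
    Function.update (counterTapes I O σ) (.inr i) (counterTape v) =
      counterTapes I O (Function.update σ i v) := by
  funext j
  rcases j with (_ | _) | j
  · rfl
  · rfl
  · by_cases h : j = i
    · subst h
      simp [counterTapes]
    · simp [counterTapes, h]

/-- Increment the counter `i`. -/
def inc (i : ι) : Fragment (Bool ⊕ ι) Unit :=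
  onTape (.inr i) fun a => (a, some .right)

theorem runs_inc (i : ι) (I O : Tape (TapeSymbol Unit)) (σ : ι → ℕ) :
    (inc i).Runs (counterTapes I O σ) (counterTapes I O (Function.update σ i (σ i + 1))) 1 := by
  refine (runs_onTape _ _ _).congr ?_ le_rfl
  rw [← update_counterTapes_counter]
  congr 1
  simp [counterTapes, MultitapeTM.act, move_right_counterTape]

/-- Decrement the counter `i` if it is nonzero. -/
def dec (i : ι) : Fragment (Bool ⊕ ι) Unit :=
  onTape (.inr i) fun a => (a, if a = none then some .left else none)

theorem runs_dec (i : ι) (I O : Tape (TapeSymbol Unit)) (σ : ι → ℕ) :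
    (dec i).Runs (counterTapes I O σ) (counterTapes I O (Function.update σ i (σ i - 1))) 1 := by
  refine (runs_onTape _ _ _).congr ?_ le_rfl
  rw [← update_counterTapes_counter]
  congr 1
  by_cases h : σ i = 0
  · have := head_counterTape_zero
    simp [counterTapes, MultitapeTM.act, h, this]
    rw [← this, Tape.write_self]
  · simp [counterTapes, MultitapeTM.act, head_counterTape_of_ne_zero h]
    rw [← head_counterTape_of_ne_zero h, Tape.write_self, move_left_counterTape _ h]

/-- Add half of the counter `x` to the counter `t`, the remainder to `p`, and clear `x`. -/
def divTwo (x t p : ι) : Fragment (Bool ⊕ ι) Unit :=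
  loop (nonzero x) ((dec x).seq (cond (nonzero x) ((dec x).seq (inc t)) (inc p)))

/-- Each round takes two units from `x`, except possibly the last. The counters `t` and `p` may
coincide, hence the sum of two `Pi.single`. -/
theorem runs_divTwo {x t p : ι} (ht : t ≠ x) (hp : p ≠ x) (I O : Tape (TapeSymbol Unit))
    (n : ℕ) (σ : ι → ℕ) (hn : σ x = n) :
    (divTwo x t p).Runs (counterTapes I O σ)
      (counterTapes I O
        (Function.update (σ + Pi.single t (n / 2) + Pi.single p (n % 2)) x 0)) (5 * n + 1) := by
  induction n using Nat.strong_induction_on generalizing σ with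
  | _ n ih =>
    rcases Nat.eq_zero_or_pos n with rfl | hpos
    · refine (runs_loop_false (nonzero_heads_false hn)).congr ?_ le_rfl
      congr 1
      funext j
      by_cases h : j = x <;> simp [h, hn]
    · have hx : σ x ≠ 0 := by omega
      by_cases h1 : n = 1
      · subst h1
        refine (Runs.loop_true (nonzero_heads_true hx) ((runs_dec x I O σ).seq
          (Runs.cond_false (nonzero_heads_false (by simp [hn])) (runs_inc p I O _)))
          (ih 0 (by omega) _ (by simp [hn, hp.symm]))).congr ?_ (by omega)
        congr 1
        funext j
        simp only [Function.update_apply, Pi.add_apply, Pi.single_apply]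
        split_ifs <;> simp_all
      · refine (Runs.loop_true (nonzero_heads_true hx) ((runs_dec x I O σ).seq
          (Runs.cond_true (nonzero_heads_true ?_) ((runs_dec x I O _).seq (runs_inc t I O _))))
          (ih (n - 2) (by omega) _ ?_)).congr ?_ (by omega)
        · simp [hn]; omega
        · simp [hn, ht.symm]; omega
        · congr 1
          funext j
          simp only [Function.update_apply, Pi.add_apply, Pi.single_apply]
          split_ifs <;> simp_all <;> omega

/-- Add the counter `s` to the counter `x` and clear `s`. -/
def transfer (s x : ι) : Fragment (Bool ⊕ ι) Unit :=
  loop (nonzero s) ((dec s).seq (inc x))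

theorem runs_transfer {s x : ι} (hs : s ≠ x) (I O : Tape (TapeSymbol Unit))
    (n : ℕ) (σ : ι → ℕ) (hn : σ s = n) :
    (transfer s x).Runs (counterTapes I O σ)
      (counterTapes I O (Function.update (Function.update σ x (σ x + n)) s 0)) (3 * n + 1) := by
  induction n generalizing σ with
  | zero =>
    refine (runs_loop_false (nonzero_heads_false hn)).congr ?_ le_rfl
    congr 1
    funext j
    by_cases h : j = s <;> simp [h, hn]
  | succ n ih =>
    refine (Runs.loop_true (nonzero_heads_true (by omega)) ((runs_dec s I O σ).seq
      (runs_inc x I O _)) (ih _ (by simp [hn, hs]))).congr ?_ (by omega)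
    congr 1
    funext j
    simp only [Function.update_apply]
    split_ifs <;> simp_all
    omega

/-- The function `f` can be computed in linear time on the counter `0`, using the counters
`1, …, b - 1` for intermediate results. -/
def CounterComputable (N b : ℕ) (f : ℕ → ℕ) : Prop :=
  ∃ (F : Fragment (Bool ⊕ Fin (N + 3)) Unit) (C : ℕ),
    ∀ (I O : Tape (TapeSymbol Unit)) (σ : Fin (N + 3) → ℕ),
      (∀ i : Fin (N + 3), i ≠ 0 → i.val < b → σ i = 0) →
      F.Runs (counterTapes I O σ) (counterTapes I O (Function.update σ 0 (f (σ 0))))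
        (C * (σ 0 + 1))

/-! ### Linear-time computation of the inverses on counters -/

theorem counterComputable_half (N : ℕ) : CounterComputable N 2 fun n => (n + 1) / 2 := by
  have h10 : (1 : Fin (N + 3)) ≠ 0 := by simp
  -- Collecting quotient and remainder on the same counter gives `n / 2 + n % 2 = (n + 1) / 2`.
  refine ⟨(divTwo 0 1 1).seq (transfer 1 0), 10, fun I O σ hσ => ?_⟩
  have h1 : σ 1 = 0 := hσ 1 h10 (by simp)
  refine ((runs_divTwo h10 h10 I O _ σ rfl).seq
    (runs_transfer h10 I O ((σ 0 + 1) / 2) _ ?_)).congr ?_ (by omega)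
  · simp [h1]; omega
  · congr 1
    funext j
    simp only [Function.update_apply, Pi.add_apply, Pi.single_apply]
    split_ifs <;> simp_all

/-- Iterating `F`, which computes a function `f` on the counter `x`, until `x` is at most `1`,
counting the iterations in `s`. The loop keeps the predecessor of the current value in `x`. -/
def countIterates (x s : ι) (F : Fragment (Bool ⊕ ι) Unit) : Fragment (Bool ⊕ ι) Unit :=
  (dec x).seq ((loop (nonzero x) ((inc x).seq (F.seq ((inc s).seq (dec x))))).seq (transfer s x))

/-- Since `f` halves its argument, the costs of the rounds form a geometric series. The fresh
counter `b` counts the rounds; the run of `f` leaves it untouched and returns its own work counters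
to zero. -/
theorem CounterComputable.countIterates {N b : ℕ} {f g : ℕ → ℕ} (hf : CounterComputable N b f)
    (hb : 0 < b) (hbN : b < N + 3) (hf₁ : ∀ n, 2 ≤ n → 1 ≤ f n) (hf₂ : ∀ n, f n ≤ (n + 1) / 2)
    (hg₁ : ∀ n, n ≤ 1 → g n = 0) (hg₂ : ∀ n, 2 ≤ n → g n = g (f n) + 1) :
    CounterComputable N (b + 1) g := by
  obtain ⟨F, C, hF⟩ := hf
  let s : Fin (N + 3) := ⟨b, hbN⟩
  have hs : s ≠ 0 := by simp [s, Fin.ext_iff]; omega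
  have hgle : ∀ n, g n ≤ n := by
    intro n
    induction n using Nat.strong_induction_on with
    | _ n ih =>
      rcases Nat.lt_or_ge n 2 with h | h
      · simp [hg₁ n (by omega)]
      · have h₁ := hf₁ n h
        have h₂ := hf₂ n
        have := ih (f n) (by omega)
        rw [hg₂ n h]
        omega
  -- The counter `0` holds `y = n - 1` for the current value `n`, so the zero test decides `n ≤ 1`,
  -- and `f n ≤ (n + 1) / 2` turns into an exact halving of `y`.
  have hloop : ∀ (I O : Tape (TapeSymbol Unit)) (y : ℕ) (σ : Fin (N + 3) → ℕ), σ 0 = y →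
      (∀ i : Fin (N + 3), i ≠ 0 → i.val < b → σ i = 0) →
      (loop (nonzero 0) ((inc 0).seq (F.seq ((inc s).seq (dec 0))))).Runs (counterTapes I O σ)
        (counterTapes I O (Function.update (Function.update σ 0 0) s (σ s + g (y + 1))))
        ((6 * C + 8) * y + 1) := by
    intro I O y
    induction y using Nat.strong_induction_on with
    | _ y ih =>
      intro σ hy hσ
      rcases Nat.eq_zero_or_pos y with rfl | hpos
      · refine (runs_loop_false (nonzero_heads_false hy)).congr ?_ (by omega)
        congr 1
        funext j
        by_cases h : j = 0
        · simp [h, hs.symm, hy]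
        · by_cases h' : j = s <;> simp [h, h', hg₁ 1 le_rfl]
      · have h₁ := hf₁ (y + 1) (by omega)
        have h₂ := hf₂ (y + 1)
        refine (Runs.loop_true (nonzero_heads_true (by omega)) ((runs_inc 0 I O σ).seq
          ((hF I O _ ?_).seq ((runs_inc s I O _).seq (runs_dec 0 I O _))))
          (ih (f (y + 1) - 1) (by omega) _ ?_ ?_)).congr ?_ ?_
        · intro i hi hib
          simp [hi, hσ i hi hib]
        · simp [hs.symm, hy]
        · intro i hi hib
          have : i ≠ s := by rintro rfl; simp [s] at hib
          simp [hi, this, hσ i hi hib]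
        · congr 1
          rw [Nat.sub_add_cancel h₁, hg₂ (y + 1) (by omega)]
          funext j
          simp only [Function.update_apply]
          split_ifs <;> simp_all
          omega
        · simp only [Function.update_self, hy]
          obtain ⟨z, hz⟩ : ∃ z, z = f (y + 1) - 1 := ⟨_, rfl⟩
          rw [← hz]
          have hz' : 2 * z ≤ y := by omega
          -- Half of `(6 * C + 8) * y` pays for the remaining rounds, as `2 * z ≤ y`; the other
          -- half, `(3 * C + 4) * y`, covers `C * (y + 2) + 4` because `y ≥ 1`.
          nlinarith [Nat.mul_le_mul_left C hz', Nat.mul_le_mul_left C hpos]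
  refine ⟨Fragment.countIterates 0 s F, 6 * C + 20, fun I O σ hσ => ?_⟩
  have hσs : σ s = 0 := hσ s hs (by simp [s])
  refine ((runs_dec 0 I O σ).seq ((hloop I O (σ 0 - 1) _ (by simp) ?_).seq
    (runs_transfer hs I O (g (σ 0)) _ ?_))).congr ?_ ?_
  · intro i hi hib
    simp [hi, hσ i hi (by omega)]
  · rcases Nat.eq_zero_or_pos (σ 0) with h | h
    · simp [h, hs, hσs, hg₁]
    · simp [hs, hσs, Nat.sub_add_cancel h]
  · congr 1
    funext j
    simp only [Function.update_apply]
    split_ifs <;> simp_all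
  · have := hgle (σ 0)
    have : (6 * C + 8) * (σ 0 - 1) ≤ (6 * C + 8) * σ 0 := Nat.mul_le_mul_left _ (by omega)
    nlinarith

theorem counterComputable_invA {N k : ℕ} (hk : k ≤ N) : CounterComputable N (k + 3) (invA k) := by
  induction k with
  | zero =>
    exact (counterComputable_half N).countIterates (by omega) (by omega) (fun n hn => by omega)
      (fun n => le_rfl) (fun n hn => (invA_eq_zero_iff 0 n).2 hn) invA_zero_eq
  | succ k ih =>
    refine (ih (by omega)).countIterates (by omega) (by omega) (fun n hn => ?_)
      (invA_le_half k) (fun n hn => (invA_eq_zero_iff _ n).2 hn) (invA_succ_eq k)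
    have := invA_eq_zero_iff k n
    omega

/-- On counters, `invA k m` can be computed from `invA 0 m` in linear time. -/
theorem exists_runs_invA {N k : ℕ} (hk : k ≤ N) :
    ∃ (F : Fragment (Bool ⊕ Fin (N + 3)) Unit) (C : ℕ),
      ∀ (I O : Tape (TapeSymbol Unit)) (m : ℕ),
        F.Runs (counterTapes I O (Pi.single 0 (invA 0 m)))
          (counterTapes I O (Pi.single 0 (invA k m))) (C * (invA 0 m + 1)) := by
  induction k with
  | zero => exact ⟨skip, 1, fun I O m => (runs_skip _).congr rfl (by omega)⟩
  | succ k ih =>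
    obtain ⟨F, C, hF⟩ := ih (by omega)
    obtain ⟨G, D, hG⟩ := counterComputable_invA hk
    -- If `invA 0 m = 0`, then `m ≤ 1` and all inverses vanish at `m`. Otherwise `invA_succ_eq`
    -- applies, and `G` runs on `invA k m ≤ invA 0 m`, never on `m` itself.
    refine ⟨cond (nonzero 0) (F.seq (G.seq (inc 0))) skip, C + D + 2, fun I O m => ?_⟩
    by_cases h : invA 0 m = 0
    · refine (Runs.cond_false (nonzero_heads_false (by simp [h])) (runs_skip _)).congr ?_ ?_
      · have : invA (k + 1) m = 0 := by rwa [invA_eq_zero_iff, ← invA_eq_zero_iff 0]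
        rw [h, this]
      · nlinarith
    · have hm : 2 ≤ m := by rw [invA_eq_zero_iff] at h; omega
      refine (Runs.cond_true (nonzero_heads_true (by simp [h])) ((hF I O m).seq
        ((hG I O _ ?_).seq (runs_inc 0 I O _)))).congr ?_ ?_
      · intro i hi _
        simp [hi]
      · congr 1
        rw [invA_succ_eq k m hm]
        funext j
        simp only [Function.update_apply, Pi.single_apply]
        split_ifs <;> simp_all
      · simp only [Pi.single_eq_same]
        have : D * (invA k m + 1) ≤ D * (invA 0 m + 1) :=
          Nat.mul_le_mul_left _ (Nat.succ_le_succ (invA_le_invA_of_le k.zero_le m))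
        nlinarith

end Fragment

end InvAck

namespace InvAck

open Turing MultitapeTM

namespace Fragment

/-! ### Reading the input and writing the output -/

theorem mk₂_cons_move_right (L : List (TapeSymbol Unit)) (a : TapeSymbol Unit)
    (w : List (TapeSymbol Unit)) :
    (Tape.mk₂ L (a :: w)).move Dir.right = Tape.mk₂ (a :: L) w := by
  rw [Tape.mk₂, Tape.move_right_mk']
  rfl

theorem wordTape_move_left_write (l : List Bool) (b : Bool) :
    ((wordTape Unit l).move Dir.left).write (some (Sum.inl b)) = wordTape Unit (b :: l) := by
  rw [wordTape, Tape.mk₁, Tape.mk₂, Tape.move_left_mk', Tape.write_mk', ListBlank.tail_cons]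
  rfl

/-- One explicit blank and the empty list represent the same half-tape. Thus the blank output tape
already has the form required to start `emitBits`. -/
theorem wordTape_nil_move_left : (wordTape Unit []).move Dir.left = wordTape Unit [] := by
  rw [wordTape, List.map_nil, Tape.mk₁, Tape.mk₂, Tape.move_left_mk']
  congr 1
  exact Quotient.sound' (Or.inr ⟨1, rfl⟩)

variable {ι : Type} [DecidableEq ι]

/-- Set all the counters to zero. -/
def initCounters : Fragment (Bool ⊕ ι) Unit :=
  single fun h j => (j.elim (fun _ => h j) fun _ => some (Sum.inr ()), none)

theorem runs_initCounters (w : List Bool) :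
    (initCounters (ι := ι)).Runs
      (fun i => if i = .inl false then wordTape Unit w else wordTape Unit [])
      (counterTapes (wordTape Unit w) (wordTape Unit []) 0) 1 := by
  refine (runs_single _ _).congr (funext fun j => ?_) le_rfl
  rcases j with (_ | _) | j
  · exact Tape.write_self _
  · exact Tape.write_self _
  · rfl

/-- Clear the counter `i`. -/
def clear (i : ι) : Fragment (Bool ⊕ ι) Unit := loop (nonzero i) (dec i)

theorem runs_clear (i : ι) (I O : Tape (TapeSymbol Unit)) (n : ℕ) (σ : ι → ℕ) (hn : σ i = n) :
    (clear i).Runs (counterTapes I O σ) (counterTapes I O (Function.update σ i 0))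
      (2 * n + 1) := by
  induction n generalizing σ with
  | zero =>
    refine (runs_loop_false (nonzero_heads_false hn)).congr ?_ le_rfl
    rw [← hn, Function.update_eq_self]
  | succ n ih =>
    exact (Runs.loop_true (nonzero_heads_true (by omega)) (runs_dec i I O σ)
      (ih _ (by simp [hn]))).congr (by simp) (by omega)

/-- Move the head of the input tape to the right. -/
def nextLetter : Fragment (Bool ⊕ ι) Unit := onTape (.inl false) fun a => (a, some .right)

theorem runs_nextLetter (I O : Tape (TapeSymbol Unit)) (σ : ι → ℕ) :
    nextLetter.Runs (counterTapes I O σ) (counterTapes (I.move .right) O σ) 1 := by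
  refine (runs_onTape _ _ _).congr ((update_counterTapes_input _ _ _ _).trans ?_) le_rfl
  simp [counterTapes, act]

/-- The test whether the scanned letter of the input is `1`. -/
def inputIsOne (h : Bool ⊕ ι → TapeSymbol Unit) : Bool :=
  decide (h (.inl false) = some (Sum.inl true))

/-- The test whether the end of the input has not been reached. -/
def inputNotBlank (h : Bool ⊕ ι → TapeSymbol Unit) : Bool := decide (h (.inl false) ≠ none)

/-- Read the input from the head on, counting the letters in `x` and the letters `1` in `p`. -/
def countLetters (x p : ι) : Fragment (Bool ⊕ ι) Unit :=
  loop inputNotBlank ((cond inputIsOne (inc p) skip).seq ((inc x).seq nextLetter))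

/-- The list `L` of cells left of the head grows during the scan and is therefore arbitrary. The
input is not needed again, so its final tape is left unspecified. -/
theorem runs_countLetters {x p : ι} (hp : p ≠ x) (O : Tape (TapeSymbol Unit)) (w : List Bool)
    (L : List (TapeSymbol Unit)) (σ : ι → ℕ) :
    ∃ I, (countLetters x p).Runs
      (counterTapes (Tape.mk₂ L (w.map fun b => some (Sum.inl b))) O σ)
      (counterTapes I O (σ + Pi.single x w.length + Pi.single p (w.count true)))
      (5 * w.length + 1) := by
  induction w generalizing L σ with
  | nil =>
    exact ⟨_, (runs_loop_false rfl).congr (by simp; rfl) le_rfl⟩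
  | cons b w ih =>
    let T := Tape.mk₂ L ((b :: w).map fun b => some (Sum.inl b) : List (TapeSymbol Unit))
    have hb : (cond inputIsOne (inc p) skip).Runs (counterTapes T O σ)
        (counterTapes T O (σ + Pi.single p (if b then 1 else 0))) 2 := by
      cases b with
      | false => exact (Runs.cond_false rfl (runs_skip _)).congr (by simp) le_rfl
      | true =>
        refine (Runs.cond_true rfl (runs_inc p T O σ)).congr ?_ le_rfl
        congr 1
        funext j
        by_cases h : j = p
        · subst h; simp
        · simp [h]
    have hm : T.move .right = Tape.mk₂ (some (Sum.inl b) :: L) (w.map fun b => some (Sum.inl b)) :=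
      mk₂_cons_move_right _ _ _
    obtain ⟨I, hI⟩ := ih (some (Sum.inl b) :: L)
      (Function.update (σ + Pi.single p (if b then 1 else 0)) x
        ((σ + Pi.single p (if b then 1 else 0) : ι → ℕ) x + 1))
    rw [← hm] at hI
    refine ⟨I, (Runs.loop_true rfl (hb.seq ((runs_inc x T O _).seq (runs_nextLetter T O _)))
      hI).congr ?_ ?_⟩
    · congr 1
      funext j
      simp only [Function.update_apply, Pi.add_apply, Pi.single_apply, List.count_cons,
        List.length_cons]
      cases b <;> split_ifs <;> simp_all <;> omega
    · simp only [List.length_cons]; omega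

/-- Compute `⌈log₂ m⌉` on the counter `0` from the binary representation of `m` on the input
tape. -/
theorem exists_runs_readInput (N : ℕ) :
    ∃ (F : Fragment (Bool ⊕ Fin (N + 3)) Unit) (C : ℕ), ∀ m : ℕ, ∃ I,
      F.Runs (fun i => if i = .inl false then wordTape Unit (binRep m) else wordTape Unit [])
        (counterTapes I (wordTape Unit []) (Pi.single 0 (invA 0 m)))
        (C * (binRep m).length) := by
  have h10 : (1 : Fin (N + 3)) ≠ 0 := by simp
  -- The first letter is `1` exactly when `m > 0`. It is skipped; the other letters are counted, and
  -- one is added if some `1` occurs among them.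
  refine ⟨initCounters.seq (cond inputIsOne (nextLetter.seq ((countLetters 0 1).seq
    ((cond (nonzero 1) (inc 0) skip).seq (clear 1)))) skip), 10, fun m => ?_⟩
  rcases Nat.eq_zero_or_pos m with rfl | hm
  · refine ⟨wordTape Unit [false],
      ((runs_initCounters _).seq (Runs.cond_false rfl (runs_skip _))).congr ?_ (by simp [binRep])⟩
    rw [(invA_eq_zero_iff 0 0).2 (by omega), Pi.single_zero]
    rfl
  · obtain ⟨w, hw, hinv⟩ := binRep_of_pos m hm
    obtain ⟨I, hI⟩ := runs_countLetters h10 (wordTape Unit []) w [some (Sum.inl true)] 0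
    have hmove : (wordTape Unit (true :: w)).move .right =
        Tape.mk₂ [some (Sum.inl true)] (w.map fun b => some (Sum.inl b)) :=
      mk₂_cons_move_right _ _ _
    rw [← hmove] at hI
    have hcond : (cond (nonzero 1) (inc 0) skip).Runs
        (counterTapes I (wordTape Unit [])
          (0 + Pi.single 0 w.length + Pi.single 1 (w.count true) : Fin (N + 3) → ℕ))
        (counterTapes I (wordTape Unit [])
          (Pi.single 0 (invA 0 m) + Pi.single 1 (w.count true))) 2 := by
      rw [hinv]
      split_ifs with h
      · exact (Runs.cond_false (nonzero_heads_false (by simp [h])) (runs_skip _)).congr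
          (by simp) le_rfl
      · refine (Runs.cond_true (nonzero_heads_true (by simp [h])) (runs_inc 0 _ _ _)).congr
          ?_ le_rfl
        congr 1
        funext j
        by_cases hj : j = 0
        · subst hj; simp
        · simp [hj]
    refine ⟨I, ?_⟩
    rw [hw]
    refine ((runs_initCounters _).seq (Runs.cond_true rfl ((runs_nextLetter _ _ _).seq
      (hI.seq (hcond.seq (runs_clear 1 _ _ (w.count true) _ (by simp))))))).congr ?_ ?_
    · congr 1
      funext j
      by_cases hj : j = 1
      · subst hj; simp
      · simp [hj]
    · have := List.count_le_length (a := true) (l := w)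
      simp only [List.length_cons]
      omega

/-- Write a letter on the output tape and move the head to the left. -/
def emit (b : Bool) : Fragment (Bool ⊕ ι) Unit :=
  onTape (.inl true) fun _ => (some (Sum.inl b), some .left)

theorem runs_emit (b : Bool) (I : Tape (TapeSymbol Unit)) (l : List Bool) (σ : ι → ℕ) :
    (emit b).Runs (counterTapes I ((wordTape Unit l).move .left) σ)
      (counterTapes I ((wordTape Unit (b :: l)).move .left) σ) 1 := by
  refine (runs_onTape _ _ _).congr ((update_counterTapes_output _ _ _ _).trans ?_) le_rfl
  simp [counterTapes, act, wordTape_move_left_write]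

/-- Write the binary digits of the counter `x` on the output tape, from right to left. -/
def emitBits (x t p : ι) : Fragment (Bool ⊕ ι) Unit :=
  loop (nonzero x) ((divTwo x t p).seq
    ((cond (nonzero p) ((dec p).seq (emit true)) (emit false)).seq (transfer t x)))

/-- The word `l` holds the digits already written, with the head one cell to its left. The lowest
digit comes first, so writing leftwards puts the most significant digit in front; the halving of `x`
keeps the total time linear. -/
theorem runs_emitBits {x t p : ι} (ht : t ≠ x) (hp : p ≠ x) (htp : t ≠ p)
    (I : Tape (TapeSymbol Unit)) (n : ℕ) (l : List Bool) :
    (emitBits x t p).Runs (counterTapes I ((wordTape Unit l).move .left) (Pi.single x n))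
      (counterTapes I ((wordTape Unit (n.bits.reverse ++ l)).move .left) 0) (20 * n + 1) := by
  induction n using Nat.strong_induction_on generalizing l with
  | _ n ih =>
    rcases Nat.eq_zero_or_pos n with rfl | hpos
    · exact (runs_loop_false (nonzero_heads_false (by simp))).congr (by simp) le_rfl
    · have hdiv := runs_divTwo ht hp I ((wordTape Unit l).move .left) n (Pi.single x n) (by simp)
      have hbit : (cond (nonzero p) ((dec p).seq (emit true)) (emit false)).Runs
          (counterTapes I ((wordTape Unit l).move .left)
            (Function.update (Pi.single x n + Pi.single t (n / 2) + Pi.single p (n % 2)) x 0))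
          (counterTapes I ((wordTape Unit (decide (n % 2 ≠ 0) :: l)).move .left)
            (Pi.single t (n / 2))) 3 := by
        rcases Nat.mod_two_eq_zero_or_one n with h | h
        · refine (Runs.cond_false (nonzero_heads_false ?_) (runs_emit _ _ _ _)).congr ?_
            (by omega)
          · simp [h, hp, htp.symm]
          · simp only [h, ne_eq, not_true_eq_false, decide_false]
            congr 1
            funext j
            simp only [Function.update_apply, Pi.add_apply, Pi.single_apply]
            split_ifs <;> simp_all
        · refine (Runs.cond_true (nonzero_heads_true ?_) ((runs_dec p _ _ _).seq
            (runs_emit _ _ _ _))).congr ?_ (by omega)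
          · simp [h, hp]
          · simp only [h, ne_eq, one_ne_zero, not_false_eq_true, decide_true]
            congr 1
            funext j
            simp only [Function.update_apply, Pi.add_apply, Pi.single_apply]
            split_ifs <;> simp_all
      have htr := (runs_transfer ht I
        ((wordTape Unit (decide (n % 2 ≠ 0) :: l)).move .left) (n / 2) (Pi.single t (n / 2))
        (by simp)).congr (T'' := counterTapes I
          ((wordTape Unit (decide (n % 2 ≠ 0) :: l)).move .left) (Pi.single x (n / 2))) (by
        congr 1
        funext j
        simp only [Function.update_apply, Pi.single_apply]
        split_ifs <;> simp_all) le_rfl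
      refine (Runs.loop_true (nonzero_heads_true (by simp; omega)) (hdiv.seq (hbit.seq htr))
        (ih (n / 2) (by omega) _)).congr ?_ (by omega)
      rw [bits_reverse_eq_append n (by omega), List.append_assoc, List.singleton_append]

/-- Write the binary representation of the counter `0` on the output tape. -/
theorem exists_runs_writeOutput (N : ℕ) :
    ∃ (F : Fragment (Bool ⊕ Fin (N + 3)) Unit) (C : ℕ),
      ∀ (I : Tape (TapeSymbol Unit)) (n : ℕ), ∃ σ,
        F.Runs (counterTapes I (wordTape Unit []) (Pi.single 0 n))
          (counterTapes I (wordTape Unit (binRep n)) σ) (C * (n + 1)) := by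
  have h10 : (1 : Fin (N + 3)) ≠ 0 := by simp
  have h20 : (2 : Fin (N + 3)) ≠ 0 := by simp [Fin.ext_iff, Nat.mod_eq_of_lt]
  have h12 : (1 : Fin (N + 3)) ≠ 2 := by simp [Fin.ext_iff, Nat.mod_eq_of_lt]
  -- Zero is treated separately, since `Nat.bits 0` is empty while `binRep 0` is the letter `0`. The
  -- final move to the right brings the head back to the first letter.
  refine ⟨cond (nonzero 0) ((emitBits 0 1 2).seq
    (onTape (.inl true) fun a => (a, some .right)))
    (onTape (.inl true) fun _ => (some (Sum.inl false), none)), 20, fun I n => ?_⟩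
  rcases Nat.eq_zero_or_pos n with rfl | hn
  · exact ⟨_, (Runs.cond_false (nonzero_heads_false (by simp)) (runs_onTape _ _ _)).congr
      (update_counterTapes_output _ _ _ _) (by omega)⟩
  · have h := runs_emitBits h10 h20 h12 I n []
    rw [wordTape_nil_move_left, List.append_nil] at h
    refine ⟨0, (Runs.cond_true (nonzero_heads_true (by simp; omega))
      (h.seq (runs_onTape _ _ _))).congr ((update_counterTapes_output _ _ _ _).trans ?_)
      (by omega)⟩
    simp [counterTapes, act, binRep, hn.ne']

end Fragment

theorem linearTimeComputable_invA (k : ℕ) : LinearTimeComputable (invA k) := by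
  obtain ⟨F, C, hF⟩ := Fragment.exists_runs_readInput k
  obtain ⟨G, D, hG⟩ := Fragment.exists_runs_invA (le_refl k)
  obtain ⟨H, E, hH⟩ := Fragment.exists_runs_writeOutput k
  refine ⟨(F.seq (G.seq H)).toTM (.inl false) (.inl true), C + 2 * D + 2 * E, fun m => ?_⟩
  obtain ⟨I, hI⟩ := hF m
  obtain ⟨σ, hσ⟩ := hH I (invA k m)
  refine Fragment.Runs.outputsWithin (T' := Fragment.counterTapes I _ σ)
    ((hI.seq ((hG I _ m).seq hσ)).congr rfl ?_) rfl
  -- Counter values are at most `|m|`, and `|m| ≥ 1` absorbs the additional `1`; so time linear in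
  -- the counters is linear in the input length.
  have h₁ : invA 0 m + 1 ≤ 2 * (binRep m).length := by
    rcases Nat.eq_zero_or_pos m with rfl | hm
    · simp [(invA_eq_zero_iff 0 0).2, binRep]
    · obtain ⟨w, hw, hinv⟩ := binRep_of_pos m hm
      rw [hw, hinv, List.length_cons]
      split_ifs <;> omega
  have h₂ : invA k m + 1 ≤ 2 * (binRep m).length :=
    (Nat.succ_le_succ (invA_le_invA_of_le k.zero_le m)).trans h₁
  have h₃ := Nat.mul_le_mul_left D h₁
  have h₄ := Nat.mul_le_mul_left E h₂
  linarith

end InvAck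

theorem lemma3p2 (k : ℕ) :
    InvAck.LinearTimeComputable (InvAck.invA k) ∧
    (∀ m : ℕ, IsLeast {s : ℕ | (InvAck.invA k)^[s] m ≤ 1} (InvAck.invA (k + 1) m)) ∧
    (∀ m : ℕ, 4 ≤ m → InvAck.invA (k + 1) m ≤ 2 * (Nat.clog 2)^[2] m) :=
  ⟨InvAck.linearTimeComputable_invA k, InvAck.isLeast_invA_succ k,
    InvAck.invA_succ_le_two_mul_clog k⟩
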